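/- Let $q$ and $c$ be complex numbers with $|q|<1$ and $|c|<1$. For a complex number $A$ write $(A)_0=1$, $(A)_n=(1-A)(1-Aq)\cdots(1-Aq^{n-1})$ for $n\ge 1$, and $(A)_\infty=\lim_{n\to\infty}(A)_n$. Let Fine's function be defined by $$F(a,b;t):=\sum_{n=0}^{\infty}\frac{(aq)_n}{(bq)_n}\,t^n .$$ Then all the series below, including those defining $F(0,q^n;cq^n)$ for $n\ge 1$, converge absolutely, and $$\sum_{n=1}^{\infty}\frac{(-1)^{n-1}\,n\,q^{n(n+1)/2}}{(1-cq^n)(q)_n}+\sum_{n=1}^{\infty}\frac{q^{n(n+1)}(q^{n+1})_{\infty}}{(1-q^n)(q)_n}\,F(0,q^n;cq^n)=\frac{-c}{(1-c)^2}+\frac{(q)_{\infty}}{(c)_{\infty}}\left(\frac{c}{1-c}+\sum_{n=1}^{\infty}\frac{(cq)_n}{(q)_n}\,\frac{q^n}{1-q^n}\right).$$ -/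

import Mathlib

open Filter Topology

/-- The finite `q`-shifted factorial `(A; q)_n = (1 - A)(1 - A q) ⋯ (1 - A q ^ (n - 1))`,
with `(A; q)_0 = 1`. -/
def qPoch (A q : ℂ) (n : ℕ) : ℂ :=
  ∏ k ∈ Finset.range n, (1 - A * q ^ k)

/-- The infinite `q`-shifted factorial `(A; q)_∞ = lim_{n → ∞} (A; q)_n`. -/
noncomputable def qPochInf (A q : ℂ) : ℂ :=
  limUnder atTop (qPoch A q)

/-- The limit defining `(A; q)_∞` exists whenever `‖q‖ < 1`. -/
theorem tendsto_qPoch_qPochInf (A : ℂ) {q : ℂ} (hq : ‖q‖ < 1) :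
    Tendsto (qPoch A q) atTop (𝓝 (qPochInf A q)) := by
  have hs : Summable fun k : ℕ => ‖-(A * q ^ k)‖ := by
    simpa [norm_mul, norm_pow] using
      (summable_geometric_of_lt_one (norm_nonneg q) hq).mul_left ‖A‖
  have hm : Multipliable fun k : ℕ => (1 + -(A * q ^ k)) :=
    multipliable_one_add_of_summable hs
  have ht := hm.hasProd.tendsto_prod_nat
  have hl : Tendsto (qPoch A q) atTop (𝓝 (∏' k : ℕ, (1 + -(A * q ^ k)))) := by
    refine ht.congr fun n => ?_
    simp only [qPoch, sub_eq_add_neg]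
  exact tendsto_nhds_limUnder ⟨_, hl⟩

/-- Fine's function `F(a, b; t) = ∑_{n ≥ 0} (a q; q)_n / (b q; q)_n * t ^ n` (in base `q`). -/
noncomputable def fineF (q a b t : ℂ) : ℂ :=
  ∑' n : ℕ, qPoch (a * q) q n / qPoch (b * q) q n * t ^ n

/-!
The two sides are generating functions in `c`, compared coefficient by coefficient, where the
coefficients are values at `z = q ^ (m + 1)` of functions on the unit disc.

Expanding `1 / (1 - c q ^ n)` and Fine's function in powers of `c`, the coefficient of `c ^ m` on
the left is `U z + (z)_∞ R z` with `z = q ^ (m + 1)`, where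
* `U z = ∑_{n ≥ 1} (-1) ^ (n - 1) n q ^ (n (n - 1) / 2) z ^ n / (q)_n`,
* `R z = ∑_{n ≥ 1} q ^ (n ^ 2) z ^ n / ((1 - q ^ n) (q)_n (z)_n)`.

Put `H z = ∑_{n ≥ 1} z ^ n / ((1 - q ^ n) (q)_n)`. Then `U z + (z)_∞ R z = (z)_∞ H z` for
`|z| < 1` (`tsum_eulerTriDerivTerm_add_qPochInf_mul`). Indeed, replacing `z` by `z q` lowers
* `U z / (z)_∞` by `z / (1 - z)` (Euler's expansion of `(z q)_∞`),
* `H z` by `1 / (z)_∞ - 1` (Euler's expansion of `1 / (z)_∞`),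
* `R z` by `1 / (z)_∞ - 1 / (1 - z)` (Cauchy's expansion of `1 / (z)_∞`),

so that `U z / (z)_∞ + R z - H z` is unchanged under `z ↦ z q`; as it tends to `0` at the origin,
it vanishes.

Hence the left-hand side is `∑ c ^ m L m` with `L m = (q ^ (m + 1))_∞ H (q ^ (m + 1))`. The relation
for `H` gives `L m = (1 - q ^ (m + 1)) L (m + 1) + 1 - (q ^ (m + 1))_∞`, which turns
`(1 - c) ∑ c ^ m L m` into `∑ (c q) ^ m L m - c / (1 - c) + c (q)_∞ / (c)_∞`, and Euler's formula
evaluates `∑ (c q) ^ m L m` as the remaining series on the right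
(`hasSum_pow_mul_qPochInf_mul_tsum_eulerSumTerm`).
-/

/-! ### The shifted factorials -/

theorem qPoch_zero (A q : ℂ) : qPoch A q 0 = 1 := by simp [qPoch]

theorem qPoch_succ (A q : ℂ) (n : ℕ) : qPoch A q (n + 1) = qPoch A q n * (1 - A * q ^ n) :=
  Finset.prod_range_succ _ _

theorem qPoch_succ' (A q : ℂ) (n : ℕ) : qPoch A q (n + 1) = (1 - A) * qPoch (A * q) q n := by
  simp only [qPoch, Finset.prod_range_succ']
  rw [mul_comm]
  simp [pow_succ', mul_assoc]

theorem qPoch_add (A q : ℂ) (m n : ℕ) :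
    qPoch A q (m + n) = qPoch A q m * qPoch (A * q ^ m) q n := by
  simp [qPoch, Finset.prod_range_add, pow_add, mul_assoc]

theorem qPoch_zero_left (q : ℂ) (n : ℕ) : qPoch 0 q n = 1 := by simp [qPoch]

theorem qPoch_self_succ (q : ℂ) (n : ℕ) :
    qPoch q q (n + 1) = qPoch q q n * (1 - q ^ (n + 1)) := by
  rw [qPoch_succ, pow_succ']

theorem continuous_qPoch (q : ℂ) (n : ℕ) : Continuous fun A => qPoch A q n := by
  unfold qPoch; fun_prop

theorem norm_mul_pow_lt_one {A q : ℂ} (hA : ‖A‖ < 1) (hq : ‖q‖ < 1) (n : ℕ) :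
    ‖A * q ^ n‖ < 1 := by
  rw [norm_mul, norm_pow]
  exact (mul_le_of_le_one_right (norm_nonneg _) (pow_le_one₀ (norm_nonneg _) hq.le)).trans_lt hA

theorem norm_mul_lt_one {A q : ℂ} (hA : ‖A‖ < 1) (hq : ‖q‖ < 1) : ‖A * q‖ < 1 := by
  simpa using norm_mul_pow_lt_one hA hq 1

theorem one_sub_ne_zero_of_norm {z : ℂ} (hz : ‖z‖ < 1) : 1 - z ≠ 0 := by
  intro h
  rw [← sub_eq_zero.mp h] at hz
  simp at hz

theorem norm_pow_succ_lt_one {q : ℂ} (hq : ‖q‖ < 1) (n : ℕ) : ‖q ^ (n + 1)‖ < 1 := by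
  rw [pow_succ']; exact norm_mul_pow_lt_one hq hq n

theorem qPoch_ne_zero {A q : ℂ} (hA : ‖A‖ < 1) (hq : ‖q‖ < 1) (n : ℕ) : qPoch A q n ≠ 0 :=
  Finset.prod_ne_zero_iff.mpr fun k _ => one_sub_ne_zero_of_norm (norm_mul_pow_lt_one hA hq k)

theorem qPochInf_ne_zero {A q : ℂ} (hA : ‖A‖ < 1) (hq : ‖q‖ < 1) : qPochInf A q ≠ 0 := by
  have hs : Summable fun k : ℕ => ‖-(A * q ^ k)‖ := by
    simpa [norm_mul, norm_pow] using
      (summable_geometric_of_lt_one (norm_nonneg q) hq).mul_left ‖A‖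
  have hl : Tendsto (qPoch A q) atTop (𝓝 (∏' k : ℕ, (1 + -(A * q ^ k)))) := by
    refine (multipliable_one_add_of_summable hs).hasProd.tendsto_prod_nat.congr fun n => ?_
    simp only [qPoch, sub_eq_add_neg]
  rw [tendsto_nhds_unique (tendsto_qPoch_qPochInf A hq) hl]
  refine tprod_one_add_ne_zero_of_summable (fun k => ?_) hs
  rw [← sub_eq_add_neg]
  exact one_sub_ne_zero_of_norm (norm_mul_pow_lt_one hA hq k)

/-- Splitting off the first `n` factors: `(A)_∞ = (A)_n (A q ^ n)_∞`. -/
theorem qPochInf_eq_qPoch_mul (A : ℂ) {q : ℂ} (hq : ‖q‖ < 1) (n : ℕ) :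
    qPochInf A q = qPoch A q n * qPochInf (A * q ^ n) q := by
  have h1 := (tendsto_qPoch_qPochInf A hq).comp (tendsto_add_atTop_nat n)
  have h2 := (tendsto_qPoch_qPochInf (A * q ^ n) hq).const_mul (qPoch A q n)
  refine tendsto_nhds_unique h1 (h2.congr fun k => ?_)
  simp [← qPoch_add, add_comm]

/-- On a closed disc of radius less than `1`, the factorials `(z)_n` are bounded away from zero
uniformly in `n`: they are at least `∏ (1 - r |q| ^ k)` in absolute value. -/
theorem exists_norm_inv_qPoch_le {q : ℂ} (hq : ‖q‖ < 1) {r : ℝ} (hr : r < 1) :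
    ∃ K : ℝ, ∀ (n : ℕ) (z : ℂ), ‖z‖ ≤ r → ‖(qPoch z q n)⁻¹‖ ≤ K := by
  rcases lt_or_ge r 0 with h0 | h0
  · exact ⟨0, fun n z hz => absurd (norm_nonneg z) (by linarith)⟩
  have hr' : ‖(r : ℂ)‖ < 1 := by simpa [abs_of_nonneg h0] using hr
  have hq' : ‖((‖q‖ : ℝ) : ℂ)‖ < 1 := by simpa using hq
  obtain ⟨K, hK⟩ := ((tendsto_qPoch_qPochInf (r : ℂ) hq').inv₀
    (qPochInf_ne_zero hr' hq')).norm.bddAbove_range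
  refine ⟨K, fun n z hz => le_trans ?_ (hK ⟨n, rfl⟩)⟩
  change _ ≤ ‖(qPoch (r : ℂ) ((‖q‖ : ℝ) : ℂ) n)⁻¹‖
  rw [norm_inv, norm_inv]
  refine inv_anti₀ (norm_pos_iff.mpr (qPoch_ne_zero hr' hq' n)) ?_
  rw [qPoch, qPoch, norm_prod, norm_prod]
  refine Finset.prod_le_prod (fun _ _ => norm_nonneg _) fun k _ => ?_
  have h1 : r * ‖q‖ ^ k ≤ 1 :=
    mul_le_one₀ hr.le (by positivity) (pow_le_one₀ (norm_nonneg _) hq.le)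
  have h2 : ‖1 - (r : ℂ) * ((‖q‖ : ℝ) : ℂ) ^ k‖ = 1 - r * ‖q‖ ^ k := by
    rw [← Complex.ofReal_pow, ← Complex.ofReal_mul, ← Complex.ofReal_one, ← Complex.ofReal_sub,
      Complex.norm_real, Real.norm_of_nonneg (by linarith)]
  rw [h2]
  have h3 : ‖z * q ^ k‖ ≤ r * ‖q‖ ^ k := by
    rw [norm_mul, norm_pow]; gcongr
  have h4 := norm_sub_norm_le (1 : ℂ) (z * q ^ k)
  rw [norm_one] at h4
  linarith

theorem norm_inv_one_sub_pow_succ_le {q : ℂ} (hq : ‖q‖ < 1) (n : ℕ) :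
    ‖(1 - q ^ (n + 1))⁻¹‖ ≤ (1 - ‖q‖)⁻¹ := by
  rw [norm_inv]
  refine inv_anti₀ (by linarith) ?_
  have h := norm_sub_norm_le (1 : ℂ) (q ^ (n + 1))
  have h2 : ‖q ^ (n + 1)‖ ≤ ‖q‖ := by
    rw [norm_pow]; exact pow_le_of_le_one (norm_nonneg _) hq.le (by simp)
  rw [norm_one] at h
  linarith

/-! ### Series that are geometrically bounded near the origin -/

/-- A sequence of functions that is dominated by a multiple of `(n + 1) r ^ n` on each disc
`‖z‖ ≤ r < 1`. The factor `n + 1` makes room for termwise differentiated series. -/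
def GeomBounded (u : ℕ → ℂ → ℂ) : Prop :=
  ∀ r : ℝ, 0 ≤ r → r < 1 → ∃ K : ℝ, ∀ (n : ℕ) (z : ℂ), ‖z‖ ≤ r → ‖u n z‖ ≤ K * ((n + 1) * r ^ n)

theorem summable_succ_mul_geometric {r : ℝ} (h0 : 0 ≤ r) (hr : r < 1) :
    Summable fun n : ℕ => ((n : ℝ) + 1) * r ^ n := by
  have h : ‖r‖ < 1 := by rwa [Real.norm_of_nonneg h0]
  simpa [add_mul] using (summable_pow_mul_geometric_of_norm_lt_one 1 h).add
    (summable_geometric_of_norm_lt_one h)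

/-- Uniform boundedness of a sequence of functions on each disc `‖z‖ ≤ r < 1`. -/
def UnifBounded (a : ℕ → ℂ → ℂ) : Prop :=
  ∀ r : ℝ, r < 1 → ∃ K : ℝ, ∀ (n : ℕ) (z : ℂ), ‖z‖ ≤ r → ‖a n z‖ ≤ K

theorem UnifBounded.mul {a b : ℕ → ℂ → ℂ} (ha : UnifBounded a) (hb : UnifBounded b) :
    UnifBounded fun n z => a n z * b n z := by
  intro r hr
  obtain ⟨K, hK⟩ := ha r hr
  obtain ⟨M, hM⟩ := hb r hr
  refine ⟨K * M, fun n z hz => ?_⟩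
  rw [norm_mul]
  exact mul_le_mul (hK n z hz) (hM n z hz) (norm_nonneg _) ((norm_nonneg _).trans (hK n z hz))

theorem unifBounded_of_norm_le {a : ℕ → ℂ → ℂ} (K : ℝ) (h : ∀ n z, ‖z‖ < 1 → ‖a n z‖ ≤ K) :
    UnifBounded a := fun _ hr => ⟨K, fun n z hz => h n z (hz.trans_lt hr)⟩

theorem unifBounded_pow {q : ℂ} (hq : ‖q‖ < 1) (e : ℕ → ℕ) : UnifBounded fun n _ => q ^ e n :=
  unifBounded_of_norm_le 1 fun n _ _ => by
    rw [norm_pow]; exact pow_le_one₀ (norm_nonneg _) hq.le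

theorem unifBounded_inv_qPoch {q : ℂ} (hq : ‖q‖ < 1) (e : ℕ → ℕ) :
    UnifBounded fun n z => (qPoch z q (e n))⁻¹ := fun _ hr =>
  (exists_norm_inv_qPoch_le hq hr).imp fun _ hK n z hz => hK (e n) z hz

theorem unifBounded_inv_qPoch_self {q : ℂ} (hq : ‖q‖ < 1) (e : ℕ → ℕ) :
    UnifBounded fun n _ => (qPoch q q (e n))⁻¹ :=
  (exists_norm_inv_qPoch_le hq hq).elim fun K hK =>
    unifBounded_of_norm_le K fun n _ _ => hK (e n) q le_rfl

theorem unifBounded_inv_one_sub {q : ℂ} (hq : ‖q‖ < 1) :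
    UnifBounded fun n _ => (1 - q ^ (n + 1))⁻¹ :=
  unifBounded_of_norm_le _ fun n _ _ => norm_inv_one_sub_pow_succ_le hq n

/-- Uniformly bounded coefficients of `(n + 1) z ^ n` give geometric boundedness. -/
theorem UnifBounded.geomBounded_of_eq_succ_mul {u a : ℕ → ℂ → ℂ} (ha : UnifBounded a)
    (hu : ∀ n z, u n z = (n + 1) * z ^ n * a n z) : GeomBounded u := by
  intro r h0 hr
  obtain ⟨K, hK⟩ := ha r hr
  refine ⟨K, fun n z hz => ?_⟩
  have hn : ‖(n : ℂ) + 1‖ = n + 1 := by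
    rw [← Nat.cast_add_one, Complex.norm_natCast, Nat.cast_add_one]
  rw [hu, norm_mul, norm_mul, norm_pow, hn, mul_comm]
  have := hK n z hz
  have h1 := (norm_nonneg _).trans this
  gcongr

theorem UnifBounded.geomBounded_of_eq_mul {u a : ℕ → ℂ → ℂ} (ha : UnifBounded a)
    (hu : ∀ n z, u n z = z ^ n * a n z) : GeomBounded u := by
  have hinv : UnifBounded fun n _ => ((n : ℂ) + 1)⁻¹ := unifBounded_of_norm_le 1 fun n _ _ => by
    rw [← Nat.cast_add_one, norm_inv, Complex.norm_natCast]
    exact inv_le_one_of_one_le₀ (by simp)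
  refine (hinv.mul ha).geomBounded_of_eq_succ_mul fun n z => ?_
  have : (n : ℂ) + 1 ≠ 0 := Nat.cast_add_one_ne_zero n
  rw [hu]; field_simp

theorem GeomBounded.summable {u : ℕ → ℂ → ℂ} (hu : GeomBounded u) {z : ℂ} (hz : ‖z‖ < 1) :
    Summable fun n => u n z := by
  obtain ⟨K, hK⟩ := hu ‖z‖ (norm_nonneg z) hz
  exact .of_norm_bounded ((summable_succ_mul_geometric (norm_nonneg z) hz).mul_left K)
    fun n => hK n z le_rfl

theorem GeomBounded.tendsto_tsum {u : ℕ → ℂ → ℂ} (hu : GeomBounded u)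
    (hc : ∀ n, ContinuousAt (u n) 0) :
    Tendsto (fun z => ∑' n, u n z) (𝓝 0) (𝓝 (∑' n, u n 0)) := by
  obtain ⟨K, hK⟩ := hu (1 / 2) (by norm_num) (by norm_num)
  refine tendsto_tsum_of_dominated_convergence
    ((summable_succ_mul_geometric (by norm_num) (by norm_num : (1 / 2 : ℝ) < 1)).mul_left K)
    hc ?_
  filter_upwards [Metric.closedBall_mem_nhds (0 : ℂ) (by norm_num : (0 : ℝ) < 1 / 2)] with z hz n
  exact hK n z (by simpa using hz)

/-! ### Functional equations under `z ↦ z q` -/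

theorem tendsto_mul_pow_nhds_zero {q : ℂ} (hq : ‖q‖ < 1) (z : ℂ) :
    Tendsto (fun n : ℕ => z * q ^ n) atTop (𝓝 0) := by
  simpa using (tendsto_pow_atTop_nhds_zero_of_norm_lt_one hq).const_mul z

theorem eq_of_map_mul_eq {q : ℂ} (hq : ‖q‖ < 1) {f : ℂ → ℂ} {L : ℂ}
    (hf : ∀ z, ‖z‖ < 1 → f (z * q) = f z) (hL : Tendsto f (𝓝 0) (𝓝 L)) {z : ℂ} (hz : ‖z‖ < 1) :
    f z = L := by
  have h : ∀ n : ℕ, f (z * q ^ n) = f z := by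
    intro n
    induction n with
    | zero => simp
    | succ n ih => rw [pow_succ, ← mul_assoc, hf _ (norm_mul_pow_lt_one hz hq n), ih]
  exact tendsto_nhds_unique (tendsto_const_nhds.congr fun n => (h n).symm)
    (hL.comp (tendsto_mul_pow_nhds_zero hq z))

/-- A function with limit `1` at the origin and `f (z q) = (1 - z) f z` is `1 / (z)_∞`. -/
theorem mul_qPochInf_eq_one_of_map_mul {q : ℂ} (hq : ‖q‖ < 1) {f : ℂ → ℂ}
    (hf : ∀ z, ‖z‖ < 1 → f (z * q) = (1 - z) * f z) (hL : Tendsto f (𝓝 0) (𝓝 1)) {z : ℂ}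
    (hz : ‖z‖ < 1) : f z * qPochInf z q = 1 := by
  have h : ∀ n : ℕ, f (z * q ^ n) = f z * qPoch z q n := by
    intro n
    induction n with
    | zero => simp [qPoch_zero]
    | succ n ih =>
      rw [pow_succ, ← mul_assoc, hf _ (norm_mul_pow_lt_one hz hq n), ih, qPoch_succ]; ring
  exact tendsto_nhds_unique ((tendsto_qPoch_qPochInf z hq).const_mul (f z))
    ((hL.comp (tendsto_mul_pow_nhds_zero hq z)).congr h)

/-- A function with limit `1` at the origin and `f z = (1 - z q) f (z q)` is `(z q)_∞`. -/
theorem eq_qPochInf_of_map_mul {q : ℂ} (hq : ‖q‖ < 1) {f : ℂ → ℂ}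
    (hf : ∀ z, ‖z‖ < 1 → f z = (1 - z * q) * f (z * q)) (hL : Tendsto f (𝓝 0) (𝓝 1)) {z : ℂ}
    (hz : ‖z‖ < 1) : f z = qPochInf (z * q) q := by
  have h : ∀ n : ℕ, qPoch (z * q) q n * f (z * q ^ n) = f z := by
    intro n
    induction n with
    | zero => simp [qPoch_zero]
    | succ n ih =>
      rw [← ih, hf _ (norm_mul_pow_lt_one hz hq n), qPoch_succ]; ring_nf
  have := (tendsto_qPoch_qPochInf (z * q) hq).mul (hL.comp (tendsto_mul_pow_nhds_zero hq z))
  rw [mul_one] at this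
  exact tendsto_nhds_unique (tendsto_const_nhds.congr fun n => (h n).symm) this

section

variable {q : ℂ}

/-! ### The series and their terms -/

/-- The terms of Euler's series `∑ z ^ n / (q)_n = 1 / (z)_∞`. -/
noncomputable def eulerTerm (q : ℂ) (n : ℕ) (z : ℂ) : ℂ := z ^ n / qPoch q q n

/-- The terms of Euler's series `∑ (-1) ^ n q ^ (n (n + 1) / 2) z ^ n / (q)_n = (z q)_∞`. -/
noncomputable def eulerTriTerm (q : ℂ) (n : ℕ) (z : ℂ) : ℂ :=
  (-1) ^ n * q ^ (n * (n + 1) / 2) * z ^ n / qPoch q q n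

/-- The terms, indexed from `n + 1`, of `-z (d/dz) (z)_∞`, where `(z)_∞` is expanded by Euler's
formula. -/
noncomputable def eulerTriDerivTerm (q : ℂ) (n : ℕ) (z : ℂ) : ℂ :=
  (-1) ^ n * (n + 1) * q ^ (n * (n + 1) / 2) * z ^ (n + 1) / qPoch q q (n + 1)

/-- The terms of Cauchy's series `∑ q ^ (n ^ 2) z ^ n / ((q)_n (z)_{n + 1}) = 1 / (z)_∞`. -/
noncomputable def cauchyTerm (q : ℂ) (n : ℕ) (z : ℂ) : ℂ :=
  q ^ (n ^ 2) * z ^ n / (qPoch q q n * qPoch z q (n + 1))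

/-- The terms, indexed from `n + 1`, of `∑_{n ≥ 1} z ^ n / ((1 - q ^ n) (q)_n)`. -/
noncomputable def eulerSumTerm (q : ℂ) (n : ℕ) (z : ℂ) : ℂ :=
  z ^ (n + 1) / ((1 - q ^ (n + 1)) * qPoch q q (n + 1))

/-- The terms, indexed from `n + 1`, of
`∑_{n ≥ 1} q ^ (n ^ 2) z ^ n / ((1 - q ^ n) (q)_n (z)_n)`. -/
noncomputable def cauchySumTerm (q : ℂ) (n : ℕ) (z : ℂ) : ℂ :=
  q ^ ((n + 1) ^ 2) * z ^ (n + 1) /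
    ((1 - q ^ (n + 1)) * qPoch q q (n + 1) * qPoch z q (n + 1))

theorem unifBounded_neg_one_pow : UnifBounded fun n _ => (-1) ^ n :=
  unifBounded_of_norm_le 1 fun n _ _ => by simp

theorem unifBounded_id : UnifBounded fun _ z => z :=
  unifBounded_of_norm_le 1 fun _ _ hz => hz.le

theorem geomBounded_eulerTerm (hq : ‖q‖ < 1) : GeomBounded (eulerTerm q) :=
  (unifBounded_inv_qPoch_self hq id).geomBounded_of_eq_mul fun _ _ => by
    simp [eulerTerm, div_eq_mul_inv]

theorem geomBounded_eulerTriTerm (hq : ‖q‖ < 1) : GeomBounded (eulerTriTerm q) :=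
  ((unifBounded_neg_one_pow.mul (unifBounded_pow hq fun n => n * (n + 1) / 2)).mul
    (unifBounded_inv_qPoch_self hq id)).geomBounded_of_eq_mul fun _ _ => by
      simp only [eulerTriTerm, div_eq_mul_inv, id]; ring

theorem geomBounded_eulerTriDerivTerm (hq : ‖q‖ < 1) : GeomBounded (eulerTriDerivTerm q) :=
  (((unifBounded_neg_one_pow.mul (unifBounded_pow hq fun n => n * (n + 1) / 2)).mul
    (unifBounded_inv_qPoch_self hq (· + 1))).mul
      unifBounded_id).geomBounded_of_eq_succ_mul fun _ _ => by
      simp only [eulerTriDerivTerm, div_eq_mul_inv]; ring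

theorem geomBounded_cauchyTerm (hq : ‖q‖ < 1) : GeomBounded (cauchyTerm q) :=
  (((unifBounded_pow hq fun n => n ^ 2).mul (unifBounded_inv_qPoch_self hq id)).mul
    (unifBounded_inv_qPoch hq (· + 1))).geomBounded_of_eq_mul fun _ _ => by
      simp only [cauchyTerm, div_eq_mul_inv, id, mul_inv]; ring

theorem geomBounded_eulerSumTerm (hq : ‖q‖ < 1) : GeomBounded (eulerSumTerm q) :=
  (((unifBounded_inv_one_sub hq).mul (unifBounded_inv_qPoch_self hq (· + 1))).mul
    unifBounded_id).geomBounded_of_eq_mul fun _ _ => by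
      simp only [eulerSumTerm, div_eq_mul_inv, mul_inv]; ring

theorem geomBounded_cauchySumTerm (hq : ‖q‖ < 1) : GeomBounded (cauchySumTerm q) :=
  (((((unifBounded_pow hq fun n => (n + 1) ^ 2).mul (unifBounded_inv_one_sub hq)).mul
    (unifBounded_inv_qPoch_self hq (· + 1))).mul (unifBounded_inv_qPoch hq (· + 1))).mul
      unifBounded_id).geomBounded_of_eq_mul fun _ _ => by
      simp only [cauchySumTerm, div_eq_mul_inv, mul_inv]; ring

theorem tendsto_tsum_eulerTerm (hq : ‖q‖ < 1) :
    Tendsto (fun z => ∑' n, eulerTerm q n z) (𝓝 0) (𝓝 1) := by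
  have h := (geomBounded_eulerTerm hq).tendsto_tsum
    fun n => ((continuous_id.pow n).div_const (qPoch q q n)).continuousAt
  rwa [tsum_eq_single 0 fun n hn => by simp [eulerTerm, hn],
    show eulerTerm q 0 0 = 1 by simp [eulerTerm, qPoch_zero]] at h

theorem tendsto_tsum_eulerTriTerm (hq : ‖q‖ < 1) :
    Tendsto (fun z => ∑' n, eulerTriTerm q n z) (𝓝 0) (𝓝 1) := by
  have h := (geomBounded_eulerTriTerm hq).tendsto_tsum
    fun n => ((continuous_const.mul (continuous_id.pow n)).div_const (qPoch q q n)).continuousAt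
  rwa [tsum_eq_single 0 fun n hn => by simp [eulerTriTerm, hn],
    show eulerTriTerm q 0 0 = 1 by simp [eulerTriTerm, qPoch_zero]] at h

theorem tendsto_tsum_eulerTriDerivTerm (hq : ‖q‖ < 1) :
    Tendsto (fun z => ∑' n, eulerTriDerivTerm q n z) (𝓝 0) (𝓝 0) := by
  have h := (geomBounded_eulerTriDerivTerm hq).tendsto_tsum fun n =>
    ((continuous_const.mul (continuous_id.pow (n + 1))).div_const
      (qPoch q q (n + 1))).continuousAt
  simpa [eulerTriDerivTerm] using h

theorem tendsto_tsum_cauchyTerm (hq : ‖q‖ < 1) :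
    Tendsto (fun z => ∑' n, cauchyTerm q n z) (𝓝 0) (𝓝 1) := by
  have h := (geomBounded_cauchyTerm hq).tendsto_tsum fun n =>
    ((continuous_const.mul (continuous_id.pow n)).continuousAt.div
      (continuous_const.mul (continuous_qPoch q (n + 1))).continuousAt
      (mul_ne_zero (qPoch_ne_zero hq hq n) (by simp [qPoch_zero_left])))
  rwa [tsum_eq_single 0 fun n hn => by simp [cauchyTerm, hn],
    show cauchyTerm q 0 0 = 1 by simp [cauchyTerm, qPoch_zero, qPoch_zero_left]] at h

theorem tendsto_tsum_eulerSumTerm (hq : ‖q‖ < 1) :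
    Tendsto (fun z => ∑' n, eulerSumTerm q n z) (𝓝 0) (𝓝 0) := by
  have h := (geomBounded_eulerSumTerm hq).tendsto_tsum fun n =>
    ((continuous_id.pow (n + 1)).div_const
      ((1 - q ^ (n + 1)) * qPoch q q (n + 1))).continuousAt
  simpa [eulerSumTerm] using h

theorem tendsto_tsum_cauchySumTerm (hq : ‖q‖ < 1) :
    Tendsto (fun z => ∑' n, cauchySumTerm q n z) (𝓝 0) (𝓝 0) := by
  have h := (geomBounded_cauchySumTerm hq).tendsto_tsum fun n =>
    ((continuous_const.mul (continuous_id.pow (n + 1))).continuousAt.div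
      (continuous_const.mul (continuous_qPoch q (n + 1))).continuousAt
      (mul_ne_zero (mul_ne_zero (one_sub_ne_zero_of_norm (norm_pow_succ_lt_one hq n))
        (qPoch_ne_zero hq hq _)) (by simp [qPoch_zero_left])))
  simpa [cauchySumTerm] using h

/-! ### Functional equations of the series -/

theorem triangle_succ (n : ℕ) : (n + 1) * (n + 1 + 1) / 2 = n * (n + 1) / 2 + (n + 1) := by
  have := Nat.triangle_succ (n + 1)
  rw [Nat.add_sub_cancel, Nat.add_sub_cancel] at this
  rw [mul_comm, this, mul_comm n]

/-- Euler's formula for `1 / (z)_∞`. -/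
theorem tsum_eulerTerm_mul_qPochInf (hq : ‖q‖ < 1) {z : ℂ} (hz : ‖z‖ < 1) :
    (∑' n, eulerTerm q n z) * qPochInf z q = 1 := by
  refine mul_qPochInf_eq_one_of_map_mul (f := fun z => ∑' n, eulerTerm q n z) hq
    (fun z hz => ?_) (tendsto_tsum_eulerTerm hq) hz
  have hs := (geomBounded_eulerTerm hq).summable hz
  have hsq := (geomBounded_eulerTerm hq).summable (norm_mul_lt_one hz hq)
  have key : ∑' n, (eulerTerm q n z - eulerTerm q n (z * q)) = z * ∑' n, eulerTerm q n z := by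
    rw [(hs.sub hsq).tsum_eq_zero_add, ← tsum_mul_left]
    simp only [eulerTerm, pow_zero, sub_self, zero_add]
    refine tsum_congr fun n => ?_
    have h1 := qPoch_ne_zero hq hq n
    have h2 := one_sub_ne_zero_of_norm (norm_pow_succ_lt_one hq n)
    rw [qPoch_self_succ]
    field_simp
    ring
  rw [hs.tsum_sub hsq] at key
  linear_combination -key

/-- Euler's expansion of `(z q)_∞`. -/
theorem tsum_eulerTriTerm (hq : ‖q‖ < 1) {z : ℂ} (hz : ‖z‖ < 1) :
    ∑' n, eulerTriTerm q n z = qPochInf (z * q) q := by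
  refine eq_qPochInf_of_map_mul (f := fun z => ∑' n, eulerTriTerm q n z) hq
    (fun z hz => ?_) (tendsto_tsum_eulerTriTerm hq) hz
  have hs := (geomBounded_eulerTriTerm hq).summable hz
  have hsq := (geomBounded_eulerTriTerm hq).summable (norm_mul_lt_one hz hq)
  have key : ∑' n, (eulerTriTerm q n z - eulerTriTerm q n (z * q)) =
      -(z * q) * ∑' n, eulerTriTerm q n (z * q) := by
    rw [(hs.sub hsq).tsum_eq_zero_add, ← tsum_mul_left]
    simp only [eulerTriTerm, pow_zero, sub_self, zero_add]
    refine tsum_congr fun n => ?_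
    have h1 := qPoch_ne_zero hq hq n
    have h2 := one_sub_ne_zero_of_norm (norm_pow_succ_lt_one hq n)
    rw [qPoch_self_succ, triangle_succ]
    field_simp
    ring
  rw [hs.tsum_sub hsq] at key
  linear_combination key

theorem tsum_eulerTriDerivTerm (hq : ‖q‖ < 1) {z : ℂ} (hz : ‖z‖ < 1) :
    ∑' n, eulerTriDerivTerm q n z =
      (1 - z) * ∑' n, eulerTriDerivTerm q n (z * q) + z * qPochInf (z * q) q := by
  rw [← tsum_eulerTriTerm hq hz]
  have hzq : ‖z * q‖ < 1 := norm_mul_lt_one hz hq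
  have hs := (geomBounded_eulerTriDerivTerm hq).summable hz
  have hsq := (geomBounded_eulerTriDerivTerm hq).summable hzq
  have ht := (geomBounded_eulerTriTerm hq).summable hz
  have hn : Summable fun n : ℕ => n * eulerTriTerm q n z := by
    rw [← summable_nat_add_iff 1]
    refine hsq.neg.congr fun n => ?_
    rw [eulerTriDerivTerm, eulerTriTerm, triangle_succ]
    push_cast
    ring
  have h0 : ∑' n : ℕ, n * eulerTriTerm q n z = -∑' n, eulerTriDerivTerm q n (z * q) := by
    rw [hn.tsum_eq_zero_add, ← tsum_neg]
    simp only [Nat.cast_zero, zero_mul, zero_add]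
    refine tsum_congr fun n => ?_
    rw [eulerTriDerivTerm, eulerTriTerm, triangle_succ]
    push_cast
    ring
  have key : ∑' n, (eulerTriDerivTerm q n z - eulerTriDerivTerm q n (z * q)) =
      z * ∑' n, (eulerTriTerm q n z + n * eulerTriTerm q n z) := by
    rw [← tsum_mul_left]
    refine tsum_congr fun n => ?_
    have h1 := qPoch_ne_zero hq hq n
    have h2 := one_sub_ne_zero_of_norm (norm_pow_succ_lt_one hq n)
    rw [eulerTriDerivTerm, eulerTriDerivTerm, eulerTriTerm, qPoch_self_succ]
    field_simp
    ring
  rw [hs.tsum_sub hsq, ht.tsum_add hn, h0] at key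
  linear_combination key

/-- Cauchy's formula for `1 / (z)_∞`. -/
theorem tsum_cauchyTerm_mul_qPochInf (hq : ‖q‖ < 1) {z : ℂ} (hz : ‖z‖ < 1) :
    (∑' n, cauchyTerm q n z) * qPochInf z q = 1 := by
  refine mul_qPochInf_eq_one_of_map_mul (f := fun z => ∑' n, cauchyTerm q n z) hq
    (fun z hz => ?_) (tendsto_tsum_cauchyTerm hq) hz
  have hzq : ‖z * q‖ < 1 := norm_mul_lt_one hz hq
  have hs := (geomBounded_cauchyTerm hq).summable hz
  have hsq := (geomBounded_cauchyTerm hq).summable hzq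
  have hz1 := one_sub_ne_zero_of_norm hz
  -- The termwise difference telescopes: it is `w n - w (n + 1)` for the `w` below.
  set w : ℕ → ℂ := fun n => (1 - q ^ n) * cauchyTerm q n z with hw
  have hw0 : Tendsto w atTop (𝓝 0) := by
    have := ((tendsto_pow_atTop_nhds_zero_of_norm_lt_one hq).const_sub 1).mul
      hs.tendsto_atTop_zero
    simpa using this
  have hsum : HasSum (fun n => (1 - z) * cauchyTerm q n z - cauchyTerm q n (z * q)) 0 := by
    refine (((hs.mul_left _).sub hsq).hasSum_iff_tendsto_nat).mpr ?_
    have hstep : ∀ n, (1 - z) * cauchyTerm q n z - cauchyTerm q n (z * q) =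
        (1 - z) * (w n - w (n + 1)) := by
      intro n
      have h1 := qPoch_ne_zero hq hq n
      have h2 := one_sub_ne_zero_of_norm (norm_pow_succ_lt_one hq n)
      have h3 := qPoch_ne_zero hzq hq n
      have h4 : 1 - z * q * q ^ n ≠ 0 := one_sub_ne_zero_of_norm (norm_mul_pow_lt_one hzq hq n)
      simp only [hw, cauchyTerm]
      rw [qPoch_self_succ, qPoch_succ' z q (n + 1), qPoch_succ' z q n, qPoch_succ (z * q) q n]
      field_simp
      ring
    simp only [hstep, ← Finset.mul_sum, Finset.sum_range_sub']
    have := (hw0.const_sub (w 0)).const_mul (1 - z)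
    simpa [hw] using this
  have := hsum.tsum_eq
  rw [(hs.mul_left _).tsum_sub hsq, tsum_mul_left] at this
  linear_combination -this

theorem tsum_eulerSumTerm_sub (hq : ‖q‖ < 1) {z : ℂ} (hz : ‖z‖ < 1) :
    ∑' n, eulerSumTerm q n z - ∑' n, eulerSumTerm q n (z * q) = ∑' n, eulerTerm q n z - 1 := by
  have hzq : ‖z * q‖ < 1 := norm_mul_lt_one hz hq
  have h0 : eulerTerm q 0 z = 1 := by simp [eulerTerm, qPoch_zero]
  rw [((geomBounded_eulerTerm hq).summable hz).tsum_eq_zero_add, h0, add_sub_cancel_left,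
    ← ((geomBounded_eulerSumTerm hq).summable hz).tsum_sub
      ((geomBounded_eulerSumTerm hq).summable hzq)]
  refine tsum_congr fun n => ?_
  have h1 := qPoch_ne_zero hq hq (n + 1)
  have h2 := one_sub_ne_zero_of_norm (norm_pow_succ_lt_one hq n)
  rw [eulerSumTerm, eulerSumTerm, eulerTerm]
  field_simp
  ring

theorem tsum_cauchySumTerm_sub (hq : ‖q‖ < 1) {z : ℂ} (hz : ‖z‖ < 1) :
    ∑' n, cauchySumTerm q n z - ∑' n, cauchySumTerm q n (z * q) =
      ∑' n, cauchyTerm q n z - (1 - z)⁻¹ := by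
  have hzq : ‖z * q‖ < 1 := norm_mul_lt_one hz hq
  have h0 : cauchyTerm q 0 z = (1 - z)⁻¹ := by simp [cauchyTerm, qPoch]
  rw [((geomBounded_cauchyTerm hq).summable hz).tsum_eq_zero_add, h0, add_sub_cancel_left,
    ← ((geomBounded_cauchySumTerm hq).summable hz).tsum_sub
      ((geomBounded_cauchySumTerm hq).summable hzq)]
  refine tsum_congr fun n => ?_
  have h1 := qPoch_ne_zero hq hq (n + 1)
  have h2 := one_sub_ne_zero_of_norm (norm_pow_succ_lt_one hq n)
  have h3 := qPoch_ne_zero hzq hq n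
  have h4 : 1 - z * q * q ^ n ≠ 0 := one_sub_ne_zero_of_norm (norm_mul_pow_lt_one hzq hq n)
  have h5 := one_sub_ne_zero_of_norm hz
  rw [cauchySumTerm, cauchySumTerm, cauchyTerm, qPoch_succ' z q (n + 1), qPoch_succ' z q n,
    qPoch_succ (z * q) q n]
  field_simp
  ring

/-- The identity of which the theorem is the generating function over the points
`z = q ^ (m + 1)`. Divided by `(z)_∞`, the difference of the two sides is invariant under
`z ↦ z q` and vanishes at the origin. -/
theorem tsum_eulerTriDerivTerm_add_qPochInf_mul (hq : ‖q‖ < 1) {z : ℂ} (hz : ‖z‖ < 1) :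
    ∑' n, eulerTriDerivTerm q n z + qPochInf z q * ∑' n, cauchySumTerm q n z =
      qPochInf z q * ∑' n, eulerSumTerm q n z := by
  have hlim : Tendsto (fun z => (∑' n, eulerTriDerivTerm q n z) * (∑' n, eulerTerm q n z) +
      ∑' n, cauchySumTerm q n z - ∑' n, eulerSumTerm q n z) (𝓝 0) (𝓝 0) := by
    simpa using (((tendsto_tsum_eulerTriDerivTerm hq).mul (tendsto_tsum_eulerTerm hq)).add
      (tendsto_tsum_cauchySumTerm hq)).sub (tendsto_tsum_eulerSumTerm hq)
  have h := eq_of_map_mul_eq hq (fun z hz => ?_) hlim hz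
  · have h1 := tsum_eulerTerm_mul_qPochInf hq hz
    linear_combination qPochInf z q * h - (∑' n, eulerTriDerivTerm q n z) * h1
  · have hzq : ‖z * q‖ < 1 := norm_mul_lt_one hz hq
    have hz1 := one_sub_ne_zero_of_norm hz
    have e1 := tsum_eulerTerm_mul_qPochInf hq hz
    have e2 := tsum_eulerTerm_mul_qPochInf hq hzq
    have e3 := tsum_cauchyTerm_mul_qPochInf hq hz
    have hP := qPochInf_eq_qPoch_mul z hq 1
    have hPne := qPochInf_ne_zero hz hq
    have hPqne := qPochInf_ne_zero hzq hq
    have hp1 : qPoch z q 1 = 1 - z := by simp [qPoch]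
    rw [pow_one, hp1] at hP
    have dU := tsum_eulerTriDerivTerm hq hz
    have dR := tsum_cauchySumTerm_sub hq hz
    have dH := tsum_eulerSumTerm_sub hq hz
    have f1 := eq_inv_of_mul_eq_one_left e1
    have f2 := eq_inv_of_mul_eq_one_left e2
    have f3 := eq_inv_of_mul_eq_one_left e3
    rw [f1] at dH
    rw [f3] at dR
    rw [f1, f2, dU, hP] at *
    have : (∑' n, cauchySumTerm q n (z * q)) - ∑' n, eulerSumTerm q n (z * q) =
      (∑' n, cauchySumTerm q n z) - ∑' n, eulerSumTerm q n z - 1 + (1 - z)⁻¹ := by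
      linear_combination dH - dR
    rw [add_sub_assoc, this]
    field_simp
    ring

/-! ### Generating functions over the points `q ^ (m + 1)` -/

theorem GeomBounded.summable_uncurry_pow_mul {u : ℕ → ℂ → ℂ} (hu : GeomBounded u) (hq : ‖q‖ < 1)
    {c : ℂ} (hc : ‖c‖ < 1) {b : ℕ → ℂ} {B : ℝ} (hb : ∀ m, ‖b m‖ ≤ B) :
    Summable (Function.uncurry fun n m => c ^ m * b m * u n (q ^ (m + 1))) := by
  obtain ⟨K, hK⟩ := hu ‖q‖ (norm_nonneg q) hq
  have hr := ((summable_succ_mul_geometric (norm_nonneg q) hq).mul_of_nonneg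
    (summable_geometric_of_lt_one (norm_nonneg c) hc) (fun n => by positivity)
    (fun n => by positivity)).mul_left (B * K)
  refine .of_norm_bounded hr fun ⟨n, m⟩ => ?_
  have h1 : ‖u n (q ^ (m + 1))‖ ≤ K * ((n + 1) * ‖q‖ ^ n) := hK n _ (by
    rw [norm_pow]; exact pow_le_of_le_one (norm_nonneg _) hq.le (by simp))
  have h2 := mul_le_mul (hb m) h1 (norm_nonneg _) ((norm_nonneg _).trans (hb m))
  simp only [Function.uncurry, norm_mul, norm_pow]
  calc ‖c‖ ^ m * ‖b m‖ * ‖u n (q ^ (m + 1))‖ = ‖c‖ ^ m * (‖b m‖ * ‖u n (q ^ (m + 1))‖) := by ring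
    _ ≤ ‖c‖ ^ m * (B * (K * ((n + 1) * ‖q‖ ^ n))) := by gcongr
    _ = _ := by ring

/-- Interchange of the sum over the points `q ^ (m + 1)` with the series evaluated at them. -/
theorem GeomBounded.hasSum_pow_mul_tsum {u : ℕ → ℂ → ℂ} (hu : GeomBounded u) (hq : ‖q‖ < 1)
    {c : ℂ} (hc : ‖c‖ < 1) {b : ℕ → ℂ} {B : ℝ} (hb : ∀ m, ‖b m‖ ≤ B) :
    HasSum (fun m => c ^ m * b m * ∑' n, u n (q ^ (m + 1)))
      (∑' n, ∑' m, c ^ m * b m * u n (q ^ (m + 1))) := by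
  have h := hu.summable_uncurry_pow_mul hq hc hb
  have hs := h.prod_symm.prod
  simp only [Function.uncurry, Prod.swap, tsum_mul_left] at hs
  rw [← h.tsum_comm]
  simpa only [tsum_mul_left] using hs.hasSum

theorem exists_norm_qPochInf_pow_le (hq : ‖q‖ < 1) :
    ∃ B : ℝ, ∀ m : ℕ, ‖qPochInf (q ^ (m + 1)) q‖ ≤ B := by
  obtain ⟨K, hK⟩ := exists_norm_inv_qPoch_le hq hq
  refine ⟨‖qPochInf q q‖ * K, fun m => ?_⟩
  have h := qPochInf_eq_qPoch_mul q hq m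
  rw [← pow_succ'] at h
  have h2 : qPochInf (q ^ (m + 1)) q = qPochInf q q * (qPoch q q m)⁻¹ := by
    rw [h, mul_comm, inv_mul_cancel_left₀ (qPoch_ne_zero hq hq m)]
  rw [h2, norm_mul]
  exact mul_le_mul_of_nonneg_left (hK m q le_rfl) (norm_nonneg _)

theorem hasSum_pow_mul_eulerTriDerivTerm (hq : ‖q‖ < 1) {c : ℂ} (hc : ‖c‖ < 1) (n : ℕ) :
    HasSum (fun m => c ^ m * 1 * eulerTriDerivTerm q n (q ^ (m + 1)))
      ((-1) ^ n * (n + 1) * q ^ ((n + 1) * (n + 1 + 1) / 2) /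
        ((1 - c * q ^ (n + 1)) * qPoch q q (n + 1))) := by
  have h := (hasSum_geometric_of_norm_lt_one (norm_mul_pow_lt_one hc hq (n + 1))).mul_left
    ((-1) ^ n * (n + 1) * q ^ ((n + 1) * (n + 1 + 1) / 2) / qPoch q q (n + 1))
  convert! h using 1
  · ext m
    rw [eulerTriDerivTerm, triangle_succ]
    ring
  · rw [mul_comm (1 - _), ← div_div, div_eq_mul_inv _ (1 - _)]

theorem summable_fineF_term (hq : ‖q‖ < 1) {a t : ℂ} (ha : ‖a * q‖ < 1) (ht : ‖t‖ < 1) :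
    Summable fun m => qPoch (0 * q) q m / qPoch (a * q) q m * t ^ m := by
  obtain ⟨K, hK⟩ := exists_norm_inv_qPoch_le hq ha
  refine .of_norm_bounded ((summable_geometric_of_lt_one (norm_nonneg t) ht).mul_left K)
    fun m => ?_
  rw [zero_mul, qPoch_zero_left, one_div, norm_mul, norm_pow]
  exact mul_le_mul_of_nonneg_right (hK m _ le_rfl) (by positivity)

/-- Here `(q ^ (m + 1))_∞ / (q ^ (m + 1))_{n + 1} = (q ^ (n + 2))_∞ / (q ^ (n + 2))_m`, which is how
Fine's function arises. -/
theorem tsum_pow_mul_cauchySumTerm (hq : ‖q‖ < 1) (c : ℂ) (n : ℕ) :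
    ∑' m, c ^ m * qPochInf (q ^ (m + 1)) q * cauchySumTerm q n (q ^ (m + 1)) =
      q ^ ((n + 1) * (n + 1 + 1)) * qPochInf (q ^ (n + 1 + 1)) q /
          ((1 - q ^ (n + 1)) * qPoch q q (n + 1)) *
        fineF q 0 (q ^ (n + 1)) (c * q ^ (n + 1)) := by
  rw [fineF, ← tsum_mul_left]
  refine tsum_congr fun m => ?_
  have h1 := qPochInf_eq_qPoch_mul (q ^ (m + 1)) hq (n + 1)
  have h2 := qPochInf_eq_qPoch_mul (q ^ (n + 1 + 1)) hq m
  rw [← pow_add] at h1 h2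
  rw [show n + 1 + 1 + m = m + 1 + (n + 1) by ring] at h2
  have h3 := qPoch_ne_zero hq hq (n + 1)
  have h4 := one_sub_ne_zero_of_norm (norm_pow_succ_lt_one hq n)
  have h5 := qPoch_ne_zero (norm_pow_succ_lt_one hq m) hq (n + 1)
  have h6 := qPoch_ne_zero (norm_pow_succ_lt_one hq (n + 1)) hq m
  rw [h1, h2, cauchySumTerm, zero_mul, qPoch_zero_left, ← pow_succ]
  field_simp
  ring

theorem tsum_pow_mul_eulerSumTerm (hq : ‖q‖ < 1) {c : ℂ} (hc : ‖c‖ < 1) (n : ℕ) :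
    ∑' m, (c * q) ^ m * qPochInf (q ^ (m + 1)) q * eulerSumTerm q n (q ^ (m + 1)) =
      (1 - c) * (qPochInf q q / qPochInf c q) *
        (qPoch (c * q) q (n + 1) / qPoch q q (n + 1) * (q ^ (n + 1) / (1 - q ^ (n + 1)))) := by
  have hz := norm_mul_pow_lt_one hc hq (n + 1 + 1)
  have he := eq_inv_of_mul_eq_one_left (tsum_eulerTerm_mul_qPochInf hq hz)
  have h3 := qPoch_ne_zero hq hq (n + 1)
  have h4 := one_sub_ne_zero_of_norm (norm_pow_succ_lt_one hq n)
  have h5 := qPochInf_ne_zero hz hq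
  have h6 := one_sub_ne_zero_of_norm hc
  have h7 := qPoch_ne_zero (norm_mul_lt_one hc hq) hq (n + 1)
  have hm : ∀ m, (c * q) ^ m * qPochInf (q ^ (m + 1)) q * eulerSumTerm q n (q ^ (m + 1)) =
      qPochInf q q * q ^ (n + 1) / ((1 - q ^ (n + 1)) * qPoch q q (n + 1)) *
        eulerTerm q m (c * q ^ (n + 1 + 1)) := by
    intro m
    have h1 := qPochInf_eq_qPoch_mul q hq m
    rw [← pow_succ'] at h1
    have h2 := qPoch_ne_zero hq hq m
    rw [h1, eulerSumTerm, eulerTerm]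
    field_simp
    ring
  rw [tsum_congr hm, tsum_mul_left, he, qPochInf_eq_qPoch_mul c hq (n + 1 + 1), qPoch_succ' c q (n + 1)]
  field_simp

/-- The recurrence in `m` for
`(q ^ (m + 1))_∞ ∑_{n ≥ 1} q ^ (n (m + 1)) / ((1 - q ^ n) (q)_n)`. -/
theorem qPochInf_mul_tsum_eulerSumTerm_succ (hq : ‖q‖ < 1) (m : ℕ) :
    qPochInf (q ^ (m + 1)) q * ∑' n, eulerSumTerm q n (q ^ (m + 1)) =
      (1 - q ^ (m + 1)) *
        (qPochInf (q ^ (m + 1 + 1)) q * ∑' n, eulerSumTerm q n (q ^ (m + 1 + 1))) +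
      1 - qPochInf (q ^ (m + 1)) q := by
  have hz := norm_pow_succ_lt_one hq m
  have hd := tsum_eulerSumTerm_sub hq hz
  have he := tsum_eulerTerm_mul_qPochInf hq hz
  have hP := qPochInf_eq_qPoch_mul (q ^ (m + 1)) hq 1
  rw [qPoch_succ, qPoch_zero, pow_zero, mul_one, one_mul, pow_one, ← pow_succ] at hP
  rw [← pow_succ] at hd
  linear_combination qPochInf (q ^ (m + 1)) q * hd + he +
    (∑' n, eulerSumTerm q n (q ^ (m + 1 + 1))) * hP

theorem hasSum_pow_mul_qPochInf (hq : ‖q‖ < 1) {c : ℂ} (hc : ‖c‖ < 1) :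
    HasSum (fun m => c ^ m * qPochInf (q ^ (m + 1)) q) (qPochInf q q / qPochInf c q) := by
  have h := ((geomBounded_eulerTerm hq).summable hc).hasSum.mul_left (qPochInf q q)
  rw [eq_inv_of_mul_eq_one_left (tsum_eulerTerm_mul_qPochInf hq hc), ← div_eq_mul_inv] at h
  convert! h using 1
  ext m
  have h1 := qPochInf_eq_qPoch_mul q hq m
  rw [← pow_succ'] at h1
  have h2 := qPoch_ne_zero hq hq m
  rw [h1, eulerTerm]
  field_simp

/-- The right-hand side of the theorem is the generating function in `c` of
`L m = (q ^ (m + 1))_∞ ∑_{n ≥ 1} q ^ (n (m + 1)) / ((1 - q ^ n) (q)_n)`. The recurrence for `L`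
expresses `(1 - c) ∑ c ^ m L m` through `∑ (c q) ^ m L m`, and the latter sum is evaluated by
`tsum_pow_mul_eulerSumTerm`. -/
theorem hasSum_pow_mul_qPochInf_mul_tsum_eulerSumTerm (hq : ‖q‖ < 1) {c : ℂ} (hc : ‖c‖ < 1) :
    HasSum (fun m => c ^ m * qPochInf (q ^ (m + 1)) q * ∑' n, eulerSumTerm q n (q ^ (m + 1)))
      (-c / (1 - c) ^ 2 + qPochInf q q / qPochInf c q * (c / (1 - c) +
        ∑' n : ℕ, qPoch (c * q) q (n + 1) / qPoch q q (n + 1) *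
          (q ^ (n + 1) / (1 - q ^ (n + 1))))) := by
  obtain ⟨B, hB⟩ := exists_norm_qPochInf_pow_le hq
  have hL := ((geomBounded_eulerSumTerm hq).hasSum_pow_mul_tsum hq hc hB).summable
  have hM := (geomBounded_eulerSumTerm hq).hasSum_pow_mul_tsum hq (norm_mul_lt_one hc hq) hB
  simp only [tsum_pow_mul_eulerSumTerm hq hc, tsum_mul_left] at hM
  have hP := hasSum_pow_mul_qPochInf hq hc
  have hg := hasSum_geometric_of_norm_lt_one hc
  have hc1 := one_sub_ne_zero_of_norm hc
  refine (hL.hasSum_iff).mpr ?_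
  have h1 := hL.tsum_eq_zero_add
  have h2 := hM.summable.tsum_eq_zero_add
  rw [hM.tsum_eq] at h2
  have hL1 := (summable_nat_add_iff 1).mpr hL
  have hM1 := (summable_nat_add_iff 1).mpr hM.summable
  have key := ((hL.hasSum.mul_left c).sub (hL1.hasSum.sub hM1.hasSum)).unique
    (((hg.mul_left c).sub (hP.mul_left c)).congr_fun ?_)
  · simp only [pow_zero, one_mul] at h1 h2
    have : (1 - c) * (∑' m, c ^ m * qPochInf (q ^ (m + 1)) q *
        ∑' n, eulerSumTerm q n (q ^ (m + 1))) = (1 - c) * (-c / (1 - c) ^ 2 +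
        qPochInf q q / qPochInf c q * (c / (1 - c) +
        ∑' n : ℕ, qPoch (c * q) q (n + 1) / qPoch q q (n + 1) *
          (q ^ (n + 1) / (1 - q ^ (n + 1))))) := by
      have e : (1 - c) * (-c / (1 - c) ^ 2 + qPochInf q q / qPochInf c q * (c / (1 - c) +
        ∑' n : ℕ, qPoch (c * q) q (n + 1) / qPoch q q (n + 1) *
          (q ^ (n + 1) / (1 - q ^ (n + 1))))) = -c * (1 - c)⁻¹ +
          c * (qPochInf q q / qPochInf c q) + (1 - c) * (qPochInf q q / qPochInf c q) *
          ∑' n : ℕ, qPoch (c * q) q (n + 1) / qPoch q q (n + 1) *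
          (q ^ (n + 1) / (1 - q ^ (n + 1))) := by
        field_simp
        ring
      rw [e]
      linear_combination h1 - h2 - key
    exact mul_left_cancel₀ hc1 this
  · intro m
    have := qPochInf_mul_tsum_eulerSumTerm_succ hq m
    rw [mul_pow, pow_succ c]
    linear_combination c ^ m * c * this

end

theorem theorem2p8 (q c : ℂ) (hq : ‖q‖ < 1) (hc : ‖c‖ < 1) :
    (Summable fun n : ℕ+ =>
      (-1 : ℂ) ^ ((n : ℕ) - 1) * ((n : ℕ) : ℂ) * q ^ ((n : ℕ) * ((n : ℕ) + 1) / 2) /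
        ((1 - c * q ^ (n : ℕ)) * qPoch q q (n : ℕ))) ∧
    (∀ n : ℕ+, Summable fun m : ℕ =>
      qPoch (0 * q) q m / qPoch (q ^ (n : ℕ) * q) q m * (c * q ^ (n : ℕ)) ^ m) ∧
    (Summable fun n : ℕ+ =>
      q ^ ((n : ℕ) * ((n : ℕ) + 1)) * qPochInf (q ^ ((n : ℕ) + 1)) q /
          ((1 - q ^ (n : ℕ)) * qPoch q q (n : ℕ)) *
        fineF q 0 (q ^ (n : ℕ)) (c * q ^ (n : ℕ))) ∧
    (Summable fun n : ℕ+ =>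
      qPoch (c * q) q (n : ℕ) / qPoch q q (n : ℕ) * (q ^ (n : ℕ) / (1 - q ^ (n : ℕ)))) ∧
    (∑' n : ℕ+,
        (-1 : ℂ) ^ ((n : ℕ) - 1) * ((n : ℕ) : ℂ) * q ^ ((n : ℕ) * ((n : ℕ) + 1) / 2) /
          ((1 - c * q ^ (n : ℕ)) * qPoch q q (n : ℕ))) +
      (∑' n : ℕ+,
        q ^ ((n : ℕ) * ((n : ℕ) + 1)) * qPochInf (q ^ ((n : ℕ) + 1)) q /
            ((1 - q ^ (n : ℕ)) * qPoch q q (n : ℕ)) *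
          fineF q 0 (q ^ (n : ℕ)) (c * q ^ (n : ℕ))) =
    -c / (1 - c) ^ 2 +
      qPochInf q q / qPochInf c q *
        (c / (1 - c) +
          ∑' n : ℕ+,
            qPoch (c * q) q (n : ℕ) / qPoch q q (n : ℕ) *
              (q ^ (n : ℕ) / (1 - q ^ (n : ℕ)))) := by
  obtain ⟨B, hB⟩ := exists_norm_qPochInf_pow_le hq
  have hone : ∀ _ : ℕ, ‖(1 : ℂ)‖ ≤ 1 := fun _ => norm_one.le
  have hU := geomBounded_eulerTriDerivTerm hq
  have hR := geomBounded_cauchySumTerm hq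
  have hH := geomBounded_eulerSumTerm hq
  have sU := (hU.summable_uncurry_pow_mul hq hc hone).prod
  have sR := (hR.summable_uncurry_pow_mul hq hc hB).prod
  have sH := (hH.summable_uncurry_pow_mul hq (norm_mul_lt_one hc hq) hB).prod
  have tU := hU.hasSum_pow_mul_tsum hq hc hone
  have tR := hR.hasSum_pow_mul_tsum hq hc hB
  simp only [Function.uncurry, (hasSum_pow_mul_eulerTriDerivTerm hq hc _).tsum_eq] at sU tU
  simp only [Function.uncurry, tsum_pow_mul_cauchySumTerm hq] at sR tR
  simp only [Function.uncurry, tsum_pow_mul_eulerSumTerm hq hc] at sH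
  have hne : (1 - c) * (qPochInf q q / qPochInf c q) ≠ 0 :=
    mul_ne_zero (one_sub_ne_zero_of_norm hc)
      (div_ne_zero (qPochInf_ne_zero hq hq) (qPochInf_ne_zero hc hq))
  rw [summable_mul_left_iff hne] at sH
  refine ⟨?_, fun n => ?_, ?_, ?_, ?_⟩
  · refine (summable_pnat_iff_summable_succ (f := fun n : ℕ => (-1 : ℂ) ^ (n - 1) * (n : ℂ) *
      q ^ (n * (n + 1) / 2) / ((1 - c * q ^ n) * qPoch q q n))).mpr ?_
    simpa using sU
  · obtain ⟨k, hk⟩ := Nat.exists_eq_succ_of_ne_zero n.ne_zero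
    rw [hk]
    exact summable_fineF_term hq (norm_mul_lt_one (norm_pow_succ_lt_one hq k) hq)
      (norm_mul_pow_lt_one hc hq _)
  · exact (summable_pnat_iff_summable_succ (f := fun n : ℕ => q ^ (n * (n + 1)) *
      qPochInf (q ^ (n + 1)) q / ((1 - q ^ n) * qPoch q q n) *
        fineF q 0 (q ^ n) (c * q ^ n))).mpr sR
  · exact (summable_pnat_iff_summable_succ (f := fun n : ℕ =>
      qPoch (c * q) q n / qPoch q q n * (q ^ n / (1 - q ^ n)))).mpr sH
  · rw [tsum_pnat_eq_tsum_succ (f := fun n : ℕ => (-1 : ℂ) ^ (n - 1) * (n : ℂ) *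
        q ^ (n * (n + 1) / 2) / ((1 - c * q ^ n) * qPoch q q n)),
      tsum_pnat_eq_tsum_succ (f := fun n : ℕ => q ^ (n * (n + 1)) *
        qPochInf (q ^ (n + 1)) q / ((1 - q ^ n) * qPoch q q n) *
          fineF q 0 (q ^ n) (c * q ^ n)),
      tsum_pnat_eq_tsum_succ (f := fun n : ℕ =>
        qPoch (c * q) q n / qPoch q q n * (q ^ n / (1 - q ^ n)))]
    simp only [Nat.add_sub_cancel, Nat.cast_add_one]
    refine (tU.add tR).unique
      ((hasSum_pow_mul_qPochInf_mul_tsum_eulerSumTerm hq hc).congr_fun fun m => ?_)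
    linear_combination c ^ m *
      tsum_eulerTriDerivTerm_add_qPochInf_mul hq (norm_pow_succ_lt_one hq m)
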